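/- Let $J_{\pm}(n,3,0)$ be the graph whose vertices are the vectors in $\{-1,0,1\}^n$ with exactly $3$ nonzero coordinates, two vertices being joined by an edge when their scalar product is $0$. The support of a vertex is the set of its nonzero coordinates. There is an absolute constant $n_0$ such that for every integer $n > n_0$ the following hold. If $I$ is an independent set in $J_{\pm}(n,3,0)$ such that no coordinate belongs to the supports of all the vertices of $I$, then $$|I| \le 6n-16 .$$ Moreover, there is an independent set $I$ in $J_{\pm}(n,3,0)$ such that no coordinate belongs to the supports of all the vertices of $I$ and $|I| = 6n-16$. -/

import Mathlib

/-- The vectors of `{-1, 0, 1}^n` with exactly `k` nonzero coordinates. -/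
def JpmVertex (n k : ℕ) : Type :=
  {v : Fin n → ℤ // (∀ i, v i = -1 ∨ v i = 0 ∨ v i = 1) ∧
    (Finset.univ.filter fun i => v i ≠ 0).card = k}

/-- The support of a vertex: the set of places (coordinates) where it is nonzero. -/
def JpmVertex.supp {n k : ℕ} (v : JpmVertex n k) : Finset (Fin n) :=
  Finset.univ.filter fun i => v.1 i ≠ 0

/-- The graph `J_±(n, k, t)`: distinct vectors are joined when their scalar product is `t`.
(Distinctness only matters for `t = k`, since every vertex has scalar square `k`.) -/
def Jpm (n k : ℕ) (t : ℤ) : SimpleGraph (JpmVertex n k) where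
  Adj v w := v ≠ w ∧ v.1 ⬝ᵥ w.1 = t
  symm := ⟨fun v w h => ⟨h.1.symm, by rw [dotProduct_comm]; exact h.2⟩⟩
  loopless := ⟨fun _ h => h.1 rfl⟩

/-- No place belongs to the supports of all vertices of `I`. -/
def NoCommonPlace {n k : ℕ} (I : Finset (JpmVertex n k)) : Prop :=
  ¬ ∃ i : Fin n, ∀ v ∈ I, i ∈ v.supp

/-! Group an independent set by supports. Any two supports meet, since disjoint ones give scalar
product 0. If two supports share exactly two coordinates, the scalar product is a sum of two signs,
so it is nonzero only when the two vertices have the same product of signs there. Each such relation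
halves the 8 possible signings of a triple; this leaves 4, or 2 for relations on two different
pairs.

Call a pair heavy if it has at least four third elements, one more than the size of a triple. Every
support then meets every heavy pair, and any two heavy pairs meet, so the heavy pairs form a star or
a triangle. Supports without a heavy pair number at most 27 and contribute O(1). With at most two
heavy pairs the total is at most 4n + O(1). A triangle, or three heavy pairs at one point, allows at
most 6 for each outside coordinate, giving 6(n - 3) + 2 and 6(n - 4) + 8, both equal to 6n - 16.

Equality: take the triples with at least two elements in a fixed triple, each with all signs + and
with all signs -. -/

/-- The properties of the fibre sizes of an independent set of signed triples over its family
of supports which matter for the upper bound. -/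
structure IsTripleWeight {α : Type*} [DecidableEq α] (F : Finset (Finset α))
    (w : Finset α → ℕ) : Prop where
  card_eq : ∀ S ∈ F, S.card = 3
  inter : ∀ S ∈ F, ∀ T ∈ F, ∃ i ∈ S, i ∈ T
  no_common : ∀ i, ∃ S ∈ F, i ∉ S
  zero : ∀ S, S ∉ F → w S = 0
  le_eight : ∀ S ∈ F, w S ≤ 8
  le_four : ∀ x y z, x ≠ y → x ≠ z → y ≠ z → ∀ T ∈ F, x ∈ T → y ∈ T → z ∉ T →
    w {x, y, z} ≤ 4
  le_two : ∀ x y z, x ≠ y → x ≠ z → y ≠ z → ∀ T ∈ F, x ∈ T → y ∈ T → z ∉ T →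
    ∀ T' ∈ F, x ∈ T' → z ∈ T' → y ∉ T' → w {x, y, z} ≤ 2

/-- A pair is heavy when the sets of the family containing it have at least four different
third elements. -/
def IsHeavyPair {α : Type*} [DecidableEq α] (F : Finset (Finset α)) (x y : α) : Prop :=
  x ≠ y ∧ ∀ A : Finset α, A.card ≤ 3 → ∃ a, a ∉ A ∧ x ≠ a ∧ y ≠ a ∧ {x, y, a} ∈ F

open Classical in
/-- The members of the family which contain no heavy pair. -/
noncomputable def lightSets {α : Type*} [DecidableEq α] (F : Finset (Finset α)) :
    Finset (Finset α) :=
  F.filter fun S => ¬ ∃ x ∈ S, ∃ y ∈ S, IsHeavyPair F x y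

/-! ### Heavy pairs in an intersecting family of triples -/

section TripleWeight

variable {α : Type*} [DecidableEq α] {F : Finset (Finset α)} {w : Finset α → ℕ}

theorem mem_lightSets {S : Finset α} :
    S ∈ lightSets F ↔ S ∈ F ∧ ¬ ∃ x ∈ S, ∃ y ∈ S, IsHeavyPair F x y := by
  simp only [lightSets, Finset.mem_filter]

theorem IsHeavyPair.symm {x y : α} (h : IsHeavyPair F x y) : IsHeavyPair F y x := by
  refine ⟨h.1.symm, fun A hA => ?_⟩
  obtain ⟨a, h1, h2, h3, h4⟩ := h.2 A hA
  exact ⟨a, h1, h3, h2, by rwa [Finset.insert_comm]⟩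

theorem Finset.exists_eq_triple_of_mem {S : Finset α} (hS : S.card = 3) {x y : α} (hxy : x ≠ y)
    (hx : x ∈ S) (hy : y ∈ S) : ∃ a, x ≠ a ∧ y ≠ a ∧ S = {x, y, a} := by
  have h1 : ((S.erase x).erase y).card = 1 := by
    rw [Finset.card_erase_of_mem (Finset.mem_erase.2 ⟨hxy.symm, hy⟩),
      Finset.card_erase_of_mem hx, hS]
  obtain ⟨a, ha⟩ := Finset.card_eq_one.1 h1
  have ha' : a ∈ (S.erase x).erase y := by simp [ha]
  simp only [Finset.mem_erase] at ha'
  refine ⟨a, ha'.2.1.symm, ha'.1.symm, ?_⟩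
  rw [← ha, Finset.insert_erase (Finset.mem_erase.2 ⟨hxy.symm, hy⟩), Finset.insert_erase hx]

namespace IsTripleWeight

variable (h : IsTripleWeight F w)
include h

theorem le_eight' (S : Finset α) : w S ≤ 8 := by
  by_cases hS : S ∈ F
  · exact h.le_eight S hS
  · simp [h.zero S hS]

/-- A triple cannot contain all the third elements of a heavy pair. One lies outside `S`, so the
intersection must occur in the pair itself. -/
theorem mem_or_mem {x y : α} (hxy : IsHeavyPair F x y) {S : Finset α} (hS : S ∈ F) :
    x ∈ S ∨ y ∈ S := by
  obtain ⟨a, h1, -, -, h4⟩ := hxy.2 S (h.card_eq S hS).le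
  obtain ⟨i, hi, hiS⟩ := h.inter _ h4 S hS
  simp only [Finset.mem_insert, Finset.mem_singleton] at hi
  rcases hi with rfl | rfl | rfl <;> tauto

theorem heavy_inter {x y u v : α} (hxy : IsHeavyPair F x y) (huv : IsHeavyPair F u v) :
    x = u ∨ x = v ∨ y = u ∨ y = v := by
  obtain ⟨a, h1, -, -, h4⟩ := huv.2 {x, y} (Finset.card_le_two.trans (by norm_num))
  have := h.mem_or_mem hxy h4
  simp only [Finset.mem_insert, Finset.mem_singleton, not_or] at this h1
  have h5 := Ne.symm h1.1
  have h6 := Ne.symm h1.2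
  tauto

theorem card_light_pair_le {x y : α} (hxy : x ≠ y) (hl : ¬ IsHeavyPair F x y) :
    (F.filter fun S => x ∈ S ∧ y ∈ S).card ≤ 3 := by
  simp only [IsHeavyPair, not_and, not_forall, not_exists] at hl
  obtain ⟨A, hA, hA'⟩ := hl hxy
  refine le_trans (Finset.card_le_card (t := A.image fun a => {x, y, a}) ?_)
    (Finset.card_image_le.trans hA)
  intro S hS
  rw [Finset.mem_filter] at hS
  obtain ⟨a, h1, h2, rfl⟩ := Finset.exists_eq_triple_of_mem (h.card_eq S hS.1) hxy hS.2.1 hS.2.2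
  refine Finset.mem_image.2 ⟨a, ?_, rfl⟩
  by_contra ha
  exact hA' a ha h1 h2 hS.1

/-- Fix `A` in the family and, for each `a` in `A`, a member `B a` missing `a`. A light set contains
some `a` in `A` and some `b` in `B a`. That pair is not heavy, so it lies in at most 3 members: 3 *
3 * 3 = 27. -/
theorem card_lightSets_le : (lightSets F).card ≤ 27 := by
  rcases F.eq_empty_or_nonempty with hF | ⟨A, hA⟩
  · simp [lightSets, hF]
  choose B hB hB' using h.no_common
  let L := lightSets F
  have hsub : L ⊆ A.biUnion fun a => (B a).biUnion fun b => L.filter fun S => a ∈ S ∧ b ∈ S := by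
    intro S hS
    have hSF : S ∈ F := (mem_lightSets.1 hS).1
    obtain ⟨a, haA, haS⟩ := h.inter A hA S hSF
    obtain ⟨b, hbB, hbS⟩ := h.inter _ (hB a) S hSF
    simp only [Finset.mem_biUnion, Finset.mem_filter]
    exact ⟨a, haA, b, hbB, hS, haS, hbS⟩
  refine (Finset.card_le_card hsub).trans ?_
  have h1 : ∀ a ∈ A, ((B a).biUnion fun b => L.filter fun S => a ∈ S ∧ b ∈ S).card ≤ 9 := by
    intro a _
    refine (Finset.card_biUnion_le_card_mul _ _ 3 ?_).trans (by rw [h.card_eq _ (hB a)])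
    intro b hb
    have hab : a ≠ b := by rintro rfl; exact hB' a hb
    by_cases hh : IsHeavyPair F a b
    · rw [Finset.card_eq_zero.2]
      · norm_num
      · refine Finset.filter_eq_empty_iff.2 fun S hS hS' => ?_
        exact (mem_lightSets.1 hS).2 ⟨a, hS'.1, b, hS'.2, hh⟩
    · exact (Finset.card_le_card (Finset.filter_subset_filter _ fun S hS =>
          (mem_lightSets.1 hS).1)).trans
        (h.card_light_pair_le hab hh)
  exact (Finset.card_biUnion_le_card_mul _ _ 9 h1).trans (by rw [h.card_eq _ hA])

/-- Another third element `b` of the heavy pair gives a member meeting `{x, y, a}` exactly in `{x,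
y}`. -/
theorem le_four_of_heavy {x y a : α} (hxy : IsHeavyPair F x y) (hx : x ≠ a) (hy : y ≠ a) :
    w {x, y, a} ≤ 4 := by
  obtain ⟨b, hb, -, -, hF⟩ := hxy.2 {a} (by simp)
  rw [Finset.mem_singleton] at hb
  exact h.le_four x y a hxy.1 hx hy _ hF (by simp) (by simp) (by simp [hx.symm, hy.symm, Ne.symm hb])

theorem le_two_of_heavy {x y a : α} (hxy : IsHeavyPair F x y) (hx : x ≠ a) (hy : y ≠ a)
    {T : Finset α} (hT : T ∈ F) (hxT : x ∈ T) (haT : a ∈ T) (hyT : y ∉ T) :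
    w {x, y, a} ≤ 2 := by
  obtain ⟨b, hb, -, -, hF⟩ := hxy.2 {a} (by simp)
  rw [Finset.mem_singleton] at hb
  exact h.le_two x y a hxy.1 hx hy _ hF (by simp) (by simp)
    (by simp [hx.symm, hy.symm, Ne.symm hb]) T hT hxT haT hyT

/-- Two triples through `a` and through different heavy pairs at `x`. -/
theorem le_two_or_eq_zero {x y z a : α} (hxy : IsHeavyPair F x y) (hx : x ≠ a) (hy : y ≠ a)
    (hyz : y ≠ z) : w {x, y, a} ≤ 2 ∨ w {x, z, a} = 0 := by
  by_cases hF : {x, z, a} ∈ F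
  · exact .inl (h.le_two_of_heavy hxy hx hy hF (by simp) (by simp) (by simp [hxy.1.symm, hyz, hy]))
  · exact .inr (h.zero _ hF)

theorem le_two_of_two_heavy {x y z : α} (hxy : IsHeavyPair F x y) (hxz : IsHeavyPair F x z)
    (hyz : y ≠ z) : w {x, y, z} ≤ 2 := by
  obtain ⟨b, hb, -, -, hF⟩ := hxz.2 {y} (by simp)
  rw [Finset.mem_singleton] at hb
  exact h.le_two_of_heavy hxy hxz.1 hyz hF (by simp) (by simp) (by simp [hxy.1.symm, hyz, Ne.symm hb])

end IsTripleWeight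

-- Used to peel off the triples through one heavy pair at a time, leaving a remainder `R`.
omit [DecidableEq α] in
theorem Finset.sum_le_sum_image_add {β : Type*} [DecidableEq β] (f : β → ℕ) (g : α → β)
    (G R : Finset β) (A : Finset α) (hG : ∀ S ∈ G, S ∈ R ∨ ∃ a ∈ A, S = g a) :
    ∑ S ∈ G, f S ≤ ∑ a ∈ A, f (g a) + ∑ S ∈ R, f S := by
  have hsub : G ⊆ A.image g ∪ R := by
    intro S hS
    rw [Finset.mem_union, Finset.mem_image]
    rcases hG S hS with h1 | ⟨a, ha, rfl⟩
    · exact .inr h1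
    · exact .inl ⟨a, ha, rfl⟩
  have h1 := Finset.sum_le_sum_of_subset (f := f) hsub
  have h2 := Finset.sum_union_inter (s₁ := A.image g) (s₂ := R) (f := f)
  have h3 : ∑ S ∈ A.image g, f S ≤ ∑ a ∈ A, f (g a) :=
    Finset.sum_image_le_of_nonneg (fun _ _ => Nat.zero_le _)
  omega

/-! ### Weight bounds by configuration of heavy pairs -/

namespace IsTripleWeight

variable [Fintype α] (h : IsTripleWeight F w)
include h

omit [Fintype α] in
theorem sum_light_le : ∑ S ∈ lightSets F, w S ≤ 216 := by
  have h1 := Finset.sum_le_card_nsmul (lightSets F) (fun S => w S) 8 (fun S _ => h.le_eight' S)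
  have h2 := h.card_lightSets_le
  rw [smul_eq_mul] at h1
  omega

theorem sum_le_of_unique_heavy {x y : α} (hxy : IsHeavyPair F x y)
    (hu : ∀ u v, IsHeavyPair F u v → (u = x ∧ v = y) ∨ (u = y ∧ v = x)) :
    ∑ S ∈ F, w S ≤ 4 * Fintype.card α + 216 := by
  classical
  have h1 := Finset.sum_le_sum_image_add w (fun a => {x, y, a}) F
    (lightSets F) (Finset.univ.filter fun a => x ≠ a ∧ y ≠ a) (by
      intro S hS
      by_cases hl : ∃ x ∈ S, ∃ y ∈ S, IsHeavyPair F x y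
      · obtain ⟨u, hu1, v, hv1, huv⟩ := hl
        have hxS : x ∈ S ∧ y ∈ S := by
          rcases hu u v huv with ⟨rfl, rfl⟩ | ⟨rfl, rfl⟩ <;> tauto
        obtain ⟨a, ha1, ha2, rfl⟩ :=
          Finset.exists_eq_triple_of_mem (h.card_eq S hS) hxy.1 hxS.1 hxS.2
        exact .inr ⟨a, by simp [ha1, ha2], rfl⟩
      · exact .inl (mem_lightSets.2 ⟨hS, hl⟩))
  have h2 := h.sum_light_le
  have h3 := Finset.sum_le_card_nsmul (Finset.univ.filter fun a => x ≠ a ∧ y ≠ a)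
    (fun a => w {x, y, a}) 4 (fun a ha => by
      simp only [Finset.mem_filter, Finset.mem_univ, true_and] at ha
      exact h.le_four_of_heavy hxy ha.1 ha.2)
  have h4 : (Finset.univ.filter fun a => x ≠ a ∧ y ≠ a).card ≤ Fintype.card α :=
    Finset.card_le_univ _
  rw [smul_eq_mul] at h3
  omega

theorem sum_le_of_two_heavy {x y z : α} (hxy : IsHeavyPair F x y) (hxz : IsHeavyPair F x z)
    (hyz : y ≠ z)
    (hu : ∀ u v, IsHeavyPair F u v → u = x ∧ (v = y ∨ v = z) ∨ v = x ∧ (u = y ∨ u = z)) :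
    ∑ S ∈ F, w S ≤ 4 * Fintype.card α + 224 := by
  classical
  let A : Finset α := Finset.univ.filter fun a => x ≠ a ∧ y ≠ a ∧ z ≠ a
  let L := lightSets F
  let M := F.filter fun S => x ∈ S ∧ z ∈ S
  have h1 := Finset.sum_le_sum_image_add w (fun a => {x, y, a}) F (insert {x, y, z} L ∪ M) A (by
      intro S hS
      by_cases hl : ∃ x ∈ S, ∃ y ∈ S, IsHeavyPair F x y
      · obtain ⟨u, hu1, v, hv1, huv⟩ := hl
        have hxS : x ∈ S ∧ (y ∈ S ∨ z ∈ S) := by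
          rcases hu u v huv with ⟨rfl, rfl | rfl⟩ | ⟨rfl, rfl | rfl⟩ <;> tauto
        by_cases hzS : z ∈ S
        · left; simp [M, hS, hxS.1, hzS]
        obtain ⟨a, ha1, ha2, rfl⟩ :=
          Finset.exists_eq_triple_of_mem (h.card_eq S hS) hxy.1 hxS.1 (by tauto)
        refine .inr ⟨a, ?_, rfl⟩
        simp only [Finset.mem_insert, Finset.mem_singleton, not_or] at hzS
        simp [A, ha1, ha2, hzS]
      · refine .inl (Finset.mem_union_left _ (Finset.mem_insert_of_mem ?_))
        exact mem_lightSets.2 ⟨hS, hl⟩)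
  have h1' := Finset.sum_le_sum_image_add w (fun a => {x, z, a}) (insert {x, y, z} L ∪ M)
    (insert {x, y, z} L) A (by
      intro S hS
      rcases Finset.mem_union.1 hS with hS | hS
      · exact .inl hS
      · simp only [M, Finset.mem_filter] at hS
        obtain ⟨a, ha1, ha2, rfl⟩ :=
          Finset.exists_eq_triple_of_mem (h.card_eq S hS.1) hxz.1 hS.2.1 hS.2.2
        by_cases hya : y = a
        · subst hya
          left; simp [Finset.pair_comm]
        · exact .inr ⟨a, by simp [A, ha1, ha2, hya], rfl⟩)
  -- The light sets weigh at most 27 * 8 = 216, and `{x, y, z}` at most 8.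
  have h2 : ∑ S ∈ insert {x, y, z} L, w S ≤ 224 := by
    have h5 := h.sum_light_le
    have h6 := h.le_eight' {x, y, z}
    by_cases hm : {x, y, z} ∈ L
    · rw [Finset.insert_eq_of_mem hm]; simp only [L]; omega
    · rw [Finset.sum_insert hm]; simp only [L]; omega
  -- If both triples at `a` occur, each weighs at most 2; a single one weighs at most 4.
  have h3 := Finset.sum_le_card_nsmul A (fun a => w {x, y, a} + w {x, z, a}) 4 (fun a ha => by
      simp only [A, Finset.mem_filter, Finset.mem_univ, true_and] at ha
      have e1 := h.le_four_of_heavy hxy ha.1 ha.2.1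
      have e2 := h.le_four_of_heavy hxz ha.1 ha.2.2
      have e3 := h.le_two_or_eq_zero hxy ha.1 ha.2.1 hyz
      have e4 := h.le_two_or_eq_zero hxz ha.1 ha.2.2 hyz.symm
      omega)
  have h4 : A.card ≤ Fintype.card α := Finset.card_le_univ _
  rw [smul_eq_mul, Finset.sum_add_distrib] at h3
  omega

theorem sum_le_of_heavy_triangle {x y z : α} (hxy : IsHeavyPair F x y) (hxz : IsHeavyPair F x z)
    (hyz : IsHeavyPair F y z) : ∑ S ∈ F, w S + 16 ≤ 6 * Fintype.card α := by
  let A : Finset α := ({x, y, z} : Finset α)ᶜ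
  have hA : A.card + 3 = Fintype.card α := by
    have := Finset.card_compl_add_card ({x, y, z} : Finset α)
    rwa [Finset.card_eq_three.2 ⟨x, y, z, hxy.1, hxz.1, hyz.1, rfl⟩] at this
  have memA : ∀ a, a ∈ A ↔ x ≠ a ∧ y ≠ a ∧ z ≠ a := by
    intro a; simp [A, eq_comm]
  have hF : ∀ S ∈ F, ∀ u v t, u ≠ v → u ∈ S → v ∈ S →
      ({u, v, t} : Finset α) = {x, y, z} → S = {x, y, z} ∨ ∃ a ∈ A, S = {u, v, a} := by
    intro S hS u v t huv hu hv he
    obtain ⟨a, ha1, ha2, rfl⟩ := Finset.exists_eq_triple_of_mem (h.card_eq S hS) huv hu hv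
    by_cases hta : t = a
    · subst hta; exact .inl he
    · refine .inr ⟨a, ?_, rfl⟩
      simp only [A, ← he]
      simp [Ne.symm ha1, Ne.symm ha2, Ne.symm hta]
  let M1 := F.filter fun S => x ∈ S ∧ z ∈ S
  let M2 := F.filter fun S => y ∈ S ∧ z ∈ S
  let R : Finset (Finset α) := {{x, y, z}}
  -- A member meets all three sides of the triangle, so it contains two of the vertices.
  have h1 := Finset.sum_le_sum_image_add w (fun a => {x, y, a}) F (R ∪ M1 ∪ M2) A (by
    intro S hS
    have e1 := h.mem_or_mem hxy hS
    have e2 := h.mem_or_mem hxz hS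
    have e3 := h.mem_or_mem hyz hS
    by_cases hz : z ∈ S
    · left
      simp only [M1, M2, Finset.mem_union, Finset.mem_filter]
      tauto
    · rcases hF S hS x y z hxy.1 (by tauto) (by tauto) rfl with e | e
      · left; simp [R, e]
      · exact .inr e)
  have h2 := Finset.sum_le_sum_image_add w (fun a => {x, z, a}) (R ∪ M1 ∪ M2) (R ∪ M2) A (by
    intro S hS
    by_cases hS2 : S ∈ R ∪ M2
    · exact .inl hS2
    have hS1 : S ∈ M1 := by simp only [Finset.mem_union] at hS hS2; tauto
    simp only [M1, Finset.mem_filter] at hS1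
    rcases hF S hS1.1 x z y hxz.1 hS1.2.1 hS1.2.2 (by rw [Finset.pair_comm]) with e | e
    · left; simp [R, e]
    · exact .inr e)
  have h3 := Finset.sum_le_sum_image_add w (fun a => {y, z, a}) (R ∪ M2) R A (by
    intro S hS
    by_cases hS2 : S ∈ R
    · exact .inl hS2
    have hS1 : S ∈ M2 := by simp only [Finset.mem_union] at hS; tauto
    simp only [M2, Finset.mem_filter] at hS1
    rcases hF S hS1.1 y z x hyz.1 hS1.2.1 hS1.2.2
      (by rw [Finset.pair_comm, Finset.insert_comm]) with e | e
    · left; simp [R, e]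
    · exact .inr e)
  have h4 : ∑ S ∈ R, w S ≤ 2 := by
    simpa [R] using h.le_two_of_two_heavy hxy hxz hyz.1
  -- One triple at `a` weighs at most 4; as soon as two occur, each weighs at most 2, so three give
  -- 6.
  have h5 := Finset.sum_le_card_nsmul A
    (fun a => w {x, y, a} + w {x, z, a} + w {y, z, a}) 6 (fun a ha => by
      obtain ⟨hx, hy, hz⟩ := (memA a).1 ha
      have e1 := h.le_four_of_heavy hxy hx hy
      have e2 := h.le_four_of_heavy hxz hx hz
      have e3 := h.le_four_of_heavy hyz hy hz
      have f1 := h.le_two_or_eq_zero hxy hx hy hyz.1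
      have f2 := h.le_two_or_eq_zero hxz hx hz hyz.1.symm
      have f3 := h.le_two_or_eq_zero hxy.symm hy hx hxz.1
      have f4 := h.le_two_or_eq_zero hyz hy hz hxz.1.symm
      have f5 := h.le_two_or_eq_zero hxz.symm hz hx hxy.1
      have f6 := h.le_two_or_eq_zero hyz.symm hz hy hxy.1.symm
      rw [Finset.insert_comm y x] at f3
      rw [Finset.insert_comm z x, Finset.insert_comm z y] at f5
      rw [Finset.insert_comm z x, Finset.insert_comm z y] at f6
      rw [Finset.insert_comm y x] at f4
      omega)
  rw [smul_eq_mul, Finset.sum_add_distrib, Finset.sum_add_distrib] at h5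
  omega

/-- A member missing `x` must be `{y, z, t}`, and one exists because `x` is not common. Hence every
member through `x` also contains `y`, `z` or `t`. -/
theorem sum_le_of_heavy_claw {x y z t : α} (hxy : IsHeavyPair F x y) (hxz : IsHeavyPair F x z)
    (hxt : IsHeavyPair F x t) (hyz : y ≠ z) (hyt : y ≠ t) (hzt : z ≠ t) :
    ∑ S ∈ F, w S + 16 ≤ 6 * Fintype.card α := by
  let A : Finset α := ({x, y, z, t} : Finset α)ᶜ
  have hA : A.card + 4 = Fintype.card α := by
    have := Finset.card_compl_add_card ({x, y, z, t} : Finset α)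
    rwa [Finset.card_eq_succ.2 ⟨x, {y, z, t}, by simp [hxy.1, hxz.1, hxt.1], rfl,
      Finset.card_eq_three.2 ⟨y, z, t, hyz, hyt, hzt, rfl⟩⟩] at this
  have memA : ∀ a, a ∈ A ↔ x ≠ a ∧ y ≠ a ∧ z ≠ a ∧ t ≠ a := by
    intro a; simp [A, eq_comm]
  have hS0 : ∀ S ∈ F, x ∉ S → S = {y, z, t} := by
    intro S hS hx
    refine (Finset.eq_of_subset_of_card_le ?_ ?_).symm
    · have e1 := h.mem_or_mem hxy hS
      have e2 := h.mem_or_mem hxz hS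
      have e3 := h.mem_or_mem hxt hS
      simp only [Finset.insert_subset_iff, Finset.singleton_subset_iff]
      tauto
    · rw [h.card_eq S hS, Finset.card_eq_three.2 ⟨y, z, t, hyz, hyt, hzt, rfl⟩]
  have hyztF : {y, z, t} ∈ F := by
    obtain ⟨S, hS, hx⟩ := h.no_common x
    exact hS0 S hS hx ▸ hS
  let R : Finset (Finset α) := {{x, y, z}, {x, y, t}, {x, z, t}, {y, z, t}}
  have hF : ∀ S ∈ F, ∀ u, x ≠ u → x ∈ S → u ∈ S → u = y ∨ u = z ∨ u = t →
      S ∈ R ∨ ∃ a ∈ A, S = {x, u, a} := by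
    intro S hS u hxu hx hu hu'
    obtain ⟨a, ha1, ha2, rfl⟩ := Finset.exists_eq_triple_of_mem (h.card_eq S hS) hxu hx hu
    by_cases ha : a ∈ A
    · exact .inr ⟨a, ha, rfl⟩
    · left
      simp only [memA, not_and_or, not_not] at ha
      have c1 := Finset.pair_comm z y
      have c2 := Finset.pair_comm t y
      have c3 := Finset.pair_comm t z
      rcases hu' with rfl | rfl | rfl <;> rcases ha with rfl | rfl | rfl | rfl <;>
        first
        | exact absurd rfl ha1
        | exact absurd rfl ha2
        | simp [R, c1, c2, c3]
  let M1 := F.filter fun S => x ∈ S ∧ z ∈ S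
  let M2 := F.filter fun S => x ∈ S ∧ t ∈ S
  have h1 := Finset.sum_le_sum_image_add w (fun a => {x, y, a}) F (R ∪ M1 ∪ M2) A (by
    intro S hS
    by_cases hx : x ∈ S
    · obtain ⟨i, hi, hiS⟩ := h.inter _ hyztF S hS
      simp only [Finset.mem_insert, Finset.mem_singleton] at hi
      rcases hi with rfl | rfl | rfl
      · rcases hF S hS i hxy.1 hx hiS (.inl rfl) with e | e
        · left; simp [e]
        · exact .inr e
      · left; simp [M1, hS, hx, hiS]
      · left; simp [M2, hS, hx, hiS]
    · left; simp [R, hS0 S hS hx])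
  have h2 := Finset.sum_le_sum_image_add w (fun a => {x, z, a}) (R ∪ M1 ∪ M2) (R ∪ M2) A (by
    intro S hS
    by_cases hS2 : S ∈ R ∪ M2
    · exact .inl hS2
    have hS1 : S ∈ M1 := by simp only [Finset.mem_union] at hS hS2; tauto
    simp only [M1, Finset.mem_filter] at hS1
    rcases hF S hS1.1 z hxz.1 hS1.2.1 hS1.2.2 (by tauto) with e | e
    · left; simp [e]
    · exact .inr e)
  have h3 := Finset.sum_le_sum_image_add w (fun a => {x, t, a}) (R ∪ M2) R A (by
    intro S hS
    by_cases hS2 : S ∈ R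
    · exact .inl hS2
    have hS1 : S ∈ M2 := by simp only [Finset.mem_union] at hS; tauto
    simp only [M2, Finset.mem_filter] at hS1
    exact hF S hS1.1 t hxt.1 hS1.2.1 hS1.2.2 (by tauto))
  -- Each triple in `R` through `x` weighs at most 2. With 0, 1, 2 or 3 of them present, `{y, z, t}`
  -- weighs at most 8, 4, 2, 2, for totals 8, 6, 6, 8.
  have h4 : ∑ S ∈ R, w S ≤ 8 := by
    have e0 : ∑ S ∈ R, w S ≤ w {x, y, z} + (w {x, y, t} + (w {x, z, t} + w {y, z, t})) := by
      have hins : ∀ (s : Finset α) (Q : Finset (Finset α)),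
          ∑ S ∈ insert s Q, w S ≤ w s + ∑ S ∈ Q, w S := by
        intro s Q
        by_cases hs : s ∈ Q
        · rw [Finset.insert_eq_of_mem hs]; omega
        · rw [Finset.sum_insert hs]
      have a1 := hins {x, y, z} {{x, y, t}, {x, z, t}, {y, z, t}}
      have a2 := hins {x, y, t} {{x, z, t}, {y, z, t}}
      have a3 := hins {x, z, t} {{y, z, t}}
      rw [Finset.sum_singleton] at a3
      simp only [R]
      omega
    have e1 := h.le_two_of_two_heavy hxy hxz hyz
    have e2 := h.le_two_of_two_heavy hxy hxt hyt
    have e3 := h.le_two_of_two_heavy hxz hxt hzt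
    have e4 := h.le_eight' {y, z, t}
    have z1 := h.zero {x, y, z}
    have z2 := h.zero {x, y, t}
    have z3 := h.zero {x, z, t}
    have n1 : t ∉ ({x, y, z} : Finset α) := by simp [hxt.1.symm, hyt.symm, hzt.symm]
    have n2 : z ∉ ({x, y, t} : Finset α) := by simp [hxz.1.symm, hyz.symm, hzt]
    have n3 : y ∉ ({x, z, t} : Finset α) := by simp [hxy.1.symm, hyz, hyt]
    have q1 := fun m1 => h.le_four y z t hyz hyt hzt {x, y, z} m1 (by simp) (by simp) n1
    have q2 := fun m2 => h.le_four y t z hyt hyz hzt.symm {x, y, t} m2 (by simp) (by simp) n2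
    have q3 := fun m3 => h.le_four z t y hzt hyz.symm hyt.symm {x, z, t} m3 (by simp) (by simp) n3
    have q12 := fun m1 m2 => h.le_two y z t hyz hyt hzt {x, y, z} m1 (by simp) (by simp) n1
      {x, y, t} m2 (by simp) (by simp) n2
    have q13 := fun m1 m3 => h.le_two z y t hyz.symm hzt hyt {x, y, z} m1 (by simp) (by simp) n1
      {x, z, t} m3 (by simp) (by simp) n3
    have q23 := fun m2 m3 => h.le_two t y z hyt.symm hzt.symm hyz {x, y, t} m2 (by simp) (by simp)
      n2 {x, z, t} m3 (by simp) (by simp) n3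
    rw [Finset.pair_comm t z] at q2
    rw [Finset.pair_comm t y, Finset.insert_comm z y] at q3
    rw [Finset.insert_comm z y] at q13
    rw [Finset.insert_comm t y, Finset.pair_comm t z] at q23
    by_cases m1 : {x, y, z} ∈ F <;> by_cases m2 : {x, y, t} ∈ F <;>
      by_cases m3 : {x, z, t} ∈ F <;>
      simp only [m1, m2, m3, not_true_eq_false, not_false_eq_true, forall_const,
        false_imp_iff] at z1 z2 z3 q1 q2 q3 q12 q13 q23 <;>
      omega
  have h5 := Finset.sum_le_card_nsmul A
    (fun a => w {x, y, a} + w {x, z, a} + w {x, t, a}) 6 (fun a ha => by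
      obtain ⟨hx, hy, hz, ht⟩ := (memA a).1 ha
      have e1 := h.le_four_of_heavy hxy hx hy
      have e2 := h.le_four_of_heavy hxz hx hz
      have e3 := h.le_four_of_heavy hxt hx ht
      have f1 := h.le_two_or_eq_zero hxy hx hy hyz
      have f2 := h.le_two_or_eq_zero hxz hx hz hyz.symm
      have f3 := h.le_two_or_eq_zero hxy hx hy hyt
      have f4 := h.le_two_or_eq_zero hxt hx ht hyt.symm
      have f5 := h.le_two_or_eq_zero hxz hx hz hzt
      have f6 := h.le_two_or_eq_zero hxt hx ht hzt.symm
      omega)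
  rw [smul_eq_mul, Finset.sum_add_distrib, Finset.sum_add_distrib] at h5
  omega

theorem sum_le (hn : 200 < Fintype.card α) : ∑ S ∈ F, w S + 16 ≤ 6 * Fintype.card α := by
  classical
  by_cases h1 : ∃ x y, IsHeavyPair F x y
  · obtain ⟨x, y, hxy⟩ := h1
    by_cases h2 : ∀ u v, IsHeavyPair F u v → (u = x ∧ v = y) ∨ (u = y ∧ v = x)
    · have := h.sum_le_of_unique_heavy hxy h2
      omega
    have key : ∃ x y z, IsHeavyPair F x y ∧ IsHeavyPair F x z ∧ y ≠ z := by
      push Not at h2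
      obtain ⟨u, v, huv, e1, e2⟩ := h2
      rcases h.heavy_inter hxy huv with rfl | rfl | rfl | rfl
      · exact ⟨x, y, v, hxy, huv, fun e => e1 rfl e.symm⟩
      · exact ⟨x, y, u, hxy, huv.symm, fun e => e2 e.symm rfl⟩
      · exact ⟨y, x, v, hxy.symm, huv, fun e => e2 rfl e.symm⟩
      · exact ⟨y, x, u, hxy.symm, huv.symm, fun e => e1 e.symm rfl⟩
    obtain ⟨x, y, z, hxy, hxz, hyz⟩ := key
    by_cases h3 : IsHeavyPair F y z
    · exact h.sum_le_of_heavy_triangle hxy hxz h3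
    by_cases h4 : ∃ t, IsHeavyPair F x t ∧ y ≠ t ∧ z ≠ t
    · obtain ⟨t, hxt, hyt, hzt⟩ := h4
      exact h.sum_le_of_heavy_claw hxy hxz hxt hyz hyt hzt
    -- A heavy pair avoiding `x` would have to meet both `{x, y}` and `{x, z}`, so it would be `{y,
    -- z}`, which is excluded.
    have := h.sum_le_of_two_heavy hxy hxz hyz (by
      push Not at h4
      have h4' : ∀ t, IsHeavyPair F x t → t = y ∨ t = z := by
        intro t ht
        by_contra hc
        push Not at hc
        exact hc.2 (h4 t ht hc.1.symm).symm
      intro u v huv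
      have e1 := h.heavy_inter hxy huv
      have e2 := h.heavy_inter hxz huv
      by_cases hux : u = x
      · subst hux; exact .inl ⟨rfl, h4' v huv⟩
      by_cases hvx : v = x
      · subst hvx; exact .inr ⟨rfl, h4' u huv.symm⟩
      have e1' : y = u ∨ y = v := by
        rcases e1 with e | e | e | e
        · exact absurd e.symm hux
        · exact absurd e.symm hvx
        · exact .inl e
        · exact .inr e
      have e2' : z = u ∨ z = v := by
        rcases e2 with e | e | e | e
        · exact absurd e.symm hux
        · exact absurd e.symm hvx
        · exact .inl e
        · exact .inr e
      rcases e1' with rfl | rfl <;> rcases e2' with e | e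
      · exact absurd e.symm hyz
      · subst e; exact absurd huv h3
      · subst e; exact absurd huv.symm h3
      · exact absurd e.symm hyz)
    omega
  · have h2 := h.sum_light_le
    push Not at h1
    have h3 : lightSets F = F := Finset.filter_true_of_mem fun S _ => by
      rintro ⟨x, _, y, _, hxy⟩; exact h1 x y hxy
    rw [h3] at h2
    omega

end IsTripleWeight

end TripleWeight

/-! ### From independent sets to weighted triples -/

section Jpm

variable {n : ℕ}

theorem JpmVertex.mem_supp {k : ℕ} {v : JpmVertex n k} {i : Fin n} : i ∈ v.supp ↔ v.1 i ≠ 0 := by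
  simp [JpmVertex.supp]

theorem JpmVertex.eq_one_or_of_mem {k : ℕ} {v : JpmVertex n k} {i : Fin n} (hi : i ∈ v.supp) :
    v.1 i = 1 ∨ v.1 i = -1 := by
  rw [JpmVertex.mem_supp] at hi
  have := v.2.1 i
  tauto

theorem JpmVertex.ext_of_supp {k : ℕ} {v w : JpmVertex n k} (h : v.supp = w.supp)
    (h' : ∀ i ∈ v.supp, v.1 i = w.1 i) : v = w := by
  refine Subtype.ext (funext fun i => ?_)
  by_cases hi : i ∈ v.supp
  · exact h' i hi
  · have hi' : i ∉ w.supp := h ▸ hi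
    rw [JpmVertex.mem_supp, not_not] at hi hi'
    rw [hi, hi']

theorem JpmVertex.dotProduct_eq {k : ℕ} (v w : JpmVertex n k) :
    v.1 ⬝ᵥ w.1 = ∑ i ∈ v.supp ∩ w.supp, v.1 i * w.1 i := by
  rw [dotProduct]
  refine (Finset.sum_subset (Finset.subset_univ _) fun i _ hi => ?_).symm
  rw [Finset.mem_inter, JpmVertex.mem_supp, JpmVertex.mem_supp, not_and_or, not_not, not_not] at hi
  rcases hi with hi | hi <;> simp [hi]

theorem Jpm.dotProduct_ne_zero {I : Finset (JpmVertex n 3)}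
    (hI : (Jpm n 3 0).IsIndepSet (I : Set (JpmVertex n 3))) {v w : JpmVertex n 3}
    (hv : v ∈ I) (hw : w ∈ I) : v.1 ⬝ᵥ w.1 ≠ 0 := by
  intro h0
  by_cases hvw : v = w
  · subst hvw
    have h1 : v.1 = 0 := dotProduct_self_eq_zero.1 h0
    have h2 := v.2.2
    simp [h1] at h2
  · exact hI hv hw hvw ⟨hvw, h0⟩

/-- The scalar product reduces to two terms ±1, which cancel unless they agree. -/
theorem Jpm.mul_eq_mul {I : Finset (JpmVertex n 3)}
    (hI : (Jpm n 3 0).IsIndepSet (I : Set (JpmVertex n 3))) {v w : JpmVertex n 3}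
    (hv : v ∈ I) (hw : w ∈ I) {x y z : Fin n} (hxy : x ≠ y) (hS : v.supp = {x, y, z})
    (hx : x ∈ w.supp) (hy : y ∈ w.supp) (hz : z ∉ w.supp) :
    v.1 x * v.1 y = w.1 x * w.1 y := by
  have h0 := Jpm.dotProduct_ne_zero hI hv hw
  have hi : v.supp ∩ w.supp = {x, y} := by
    rw [hS]
    ext i
    simp only [Finset.mem_inter, Finset.mem_insert, Finset.mem_singleton]
    constructor
    · rintro ⟨rfl | rfl | rfl, h⟩ <;> tauto
    · rintro (rfl | rfl) <;> tauto
  rw [JpmVertex.dotProduct_eq, hi, Finset.sum_pair hxy] at h0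
  rcases JpmVertex.eq_one_or_of_mem (v := v) (i := x) (by simp [hS]) with a | a <;>
  rcases JpmVertex.eq_one_or_of_mem (v := v) (i := y) (by simp [hS]) with b | b <;>
  rcases JpmVertex.eq_one_or_of_mem hx with c | c <;>
  rcases JpmVertex.eq_one_or_of_mem hy with d | d <;>
  simp [a, b, c, d] at h0 ⊢

/-- If the members of a set of vertices with common support are determined by the signs on `K`,
there are at most `2 ^ #K` of them. -/
theorem JpmVertex.card_le_two_pow {k : ℕ} (G : Finset (JpmVertex n k)) (K : Finset (Fin n))
    (hK : ∀ v ∈ G, K ⊆ v.supp) (hinj : ∀ v ∈ G, ∀ w ∈ G, (∀ i ∈ K, v.1 i = w.1 i) → v = w) :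
    G.card ≤ 2 ^ K.card := by
  have h1 : (K.pi fun _ => ({1, -1} : Finset ℤ)).card = 2 ^ K.card := by
    rw [Finset.card_pi]; simp
  rw [← h1]
  refine Finset.card_le_card_of_injOn (fun v i _ => v.1 i) ?_ ?_
  · intro v hv
    simp only [Finset.mem_coe, Finset.mem_pi, Finset.mem_insert, Finset.mem_singleton]
    exact fun i hi => JpmVertex.eq_one_or_of_mem (hK v hv hi)
  · intro v hv w hw he
    exact hinj v hv w hw fun i hi => congr_fun (congr_fun he i) hi

theorem JpmVertex.eq_of_mul_eq {k : ℕ} {v w : JpmVertex n k} {x y : Fin n}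
    (hv : x ∈ v.supp) (hx : v.1 x = w.1 x) (h : v.1 x * v.1 y = w.1 x * w.1 y) :
    v.1 y = w.1 y := by
  rw [← hx] at h
  exact mul_left_cancel₀ (JpmVertex.mem_supp.1 hv) h

open Classical in
theorem Jpm.isTripleWeight {I : Finset (JpmVertex n 3)}
    (hI : (Jpm n 3 0).IsIndepSet (I : Set (JpmVertex n 3))) (hc : NoCommonPlace I) :
    IsTripleWeight (I.image JpmVertex.supp) fun S => (I.filter fun v => v.supp = S).card where
  card_eq S hS := by
    obtain ⟨v, -, rfl⟩ := Finset.mem_image.1 hS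
    exact v.2.2
  inter S hS T hT := by
    obtain ⟨v, hv, rfl⟩ := Finset.mem_image.1 hS
    obtain ⟨w, hw, rfl⟩ := Finset.mem_image.1 hT
    have h0 := Jpm.dotProduct_ne_zero hI hv hw
    rw [JpmVertex.dotProduct_eq] at h0
    obtain ⟨i, hi, -⟩ := Finset.exists_ne_zero_of_sum_ne_zero h0
    exact ⟨i, Finset.mem_inter.1 hi⟩
  no_common i := by
    rw [NoCommonPlace, not_exists] at hc
    have := hc i
    push Not at this
    obtain ⟨v, hv, hi⟩ := this
    exact ⟨_, Finset.mem_image_of_mem _ hv, hi⟩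
  zero S hS := by
    refine Finset.card_eq_zero.2 (Finset.filter_eq_empty_iff.2 fun v hv he => hS ?_)
    exact Finset.mem_image.2 ⟨v, hv, he⟩
  le_eight S hS := by
    obtain ⟨v, hv, rfl⟩ := Finset.mem_image.1 hS
    have h3 : v.supp.card = 3 := v.2.2
    refine (JpmVertex.card_le_two_pow _ v.supp ?_ ?_).trans (by rw [h3]; norm_num)
    · intro u hu
      rw [(Finset.mem_filter.1 hu).2]
    · intro u hu u' hu' h
      rw [Finset.mem_filter] at hu hu'
      exact JpmVertex.ext_of_supp (hu.2.trans hu'.2.symm) fun i hi => h i (hu.2 ▸ hi)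
  le_four x y z hxy hxz hyz T hT hx hy hz := by
    obtain ⟨t, ht, rfl⟩ := Finset.mem_image.1 hT
    -- The sign at `y` follows from the sign at `x`, because their product is dictated by `t`.
    refine (JpmVertex.card_le_two_pow _ {x, z} ?_ ?_).trans
      (by rw [Finset.card_pair hxz]; norm_num)
    · intro u hu
      rw [(Finset.mem_filter.1 hu).2]
      simp [Finset.insert_subset_iff]
    · intro u hu u' hu' h
      rw [Finset.mem_filter] at hu hu'
      have e1 := Jpm.mul_eq_mul hI hu.1 ht hxy hu.2 hx hy hz
      have e2 := Jpm.mul_eq_mul hI hu'.1 ht hxy hu'.2 hx hy hz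
      have e3 := JpmVertex.eq_of_mul_eq (by simp [hu.2]) (h x (by simp)) (e1.trans e2.symm)
      refine JpmVertex.ext_of_supp (hu.2.trans hu'.2.symm) fun i hi => ?_
      rw [hu.2, Finset.mem_insert, Finset.mem_insert, Finset.mem_singleton] at hi
      rcases hi with rfl | rfl | rfl
      · exact h _ (by simp)
      · exact e3
      · exact h _ (by simp)
  le_two x y z hxy hxz hyz T hT hx hy hz T' hT' hx' hz' hy' := by
    obtain ⟨t, ht, rfl⟩ := Finset.mem_image.1 hT
    obtain ⟨t', ht', rfl⟩ := Finset.mem_image.1 hT'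
    refine (JpmVertex.card_le_two_pow _ {x} ?_ ?_).trans (by simp)
    · intro u hu
      rw [(Finset.mem_filter.1 hu).2]
      simp
    · intro u hu u' hu' h
      rw [Finset.mem_filter] at hu hu'
      have hp := Finset.pair_comm y z
      have e1 := Jpm.mul_eq_mul hI hu.1 ht hxy hu.2 hx hy hz
      have e2 := Jpm.mul_eq_mul hI hu'.1 ht hxy hu'.2 hx hy hz
      have e3 := JpmVertex.eq_of_mul_eq (by simp [hu.2]) (h x (by simp)) (e1.trans e2.symm)
      have f1 := Jpm.mul_eq_mul hI hu.1 ht' hxz (hp ▸ hu.2) hx' hz' hy'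
      have f2 := Jpm.mul_eq_mul hI hu'.1 ht' hxz (hp ▸ hu'.2) hx' hz' hy'
      have f3 := JpmVertex.eq_of_mul_eq (by simp [hu.2]) (h x (by simp)) (f1.trans f2.symm)
      refine JpmVertex.ext_of_supp (hu.2.trans hu'.2.symm) fun i hi => ?_
      rw [hu.2, Finset.mem_insert, Finset.mem_insert, Finset.mem_singleton] at hi
      rcases hi with rfl | rfl | rfl
      · exact h _ (by simp)
      · exact e3
      · exact f3

theorem Jpm.card_le_of_noCommonPlace (hn : 200 < n) {I : Finset (JpmVertex n 3)}
    (hI : (Jpm n 3 0).IsIndepSet (I : Set (JpmVertex n 3))) (hc : NoCommonPlace I) :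
    I.card + 16 ≤ 6 * n := by
  classical
  have h1 := (Jpm.isTripleWeight hI hc).sum_le (by simpa using hn)
  rw [Fintype.card_fin] at h1
  rwa [Finset.card_eq_sum_card_image JpmVertex.supp I]

/-! ### The extremal example -/

/-- The vertex with constant nonzero entries `ε` on the support `S`. -/
def JpmVertex.ofFinset {k : ℕ} (S : Finset (Fin n)) (hS : S.card = k) (ε : ℤˣ) :
    JpmVertex n k :=
  ⟨fun i => if i ∈ S then (ε : ℤ) else 0, by
    intro i
    rcases Int.units_eq_one_or ε with rfl | rfl <;> by_cases hi : i ∈ S <;> simp [hi], by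
    simpa using hS⟩

theorem JpmVertex.supp_ofFinset {k : ℕ} (S : Finset (Fin n)) (hS : S.card = k) (ε : ℤˣ) :
    (JpmVertex.ofFinset S hS ε).supp = S := by
  ext i
  rw [JpmVertex.mem_supp]
  simp [JpmVertex.ofFinset]

/-- All terms over `S ∩ T` equal `ε * δ`, so nothing cancels. -/
theorem JpmVertex.ofFinset_dotProduct_ne_zero {k : ℕ} {S T : Finset (Fin n)} (hS : S.card = k)
    (hT : T.card = k) (ε δ : ℤˣ) (h : (S ∩ T).Nonempty) :
    (JpmVertex.ofFinset S hS ε).1 ⬝ᵥ (JpmVertex.ofFinset T hT δ).1 ≠ 0 := by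
  have h1 : ∀ i ∈ S ∩ T, (JpmVertex.ofFinset S hS ε).1 i * (JpmVertex.ofFinset T hT δ).1 i
      = (ε : ℤ) * δ := by
    intro i hi
    rw [Finset.mem_inter] at hi
    simp [JpmVertex.ofFinset, hi.1, hi.2]
  rw [JpmVertex.dotProduct_eq, JpmVertex.supp_ofFinset, JpmVertex.supp_ofFinset,
    Finset.sum_congr rfl h1, Finset.sum_const, nsmul_eq_mul]
  simp only [ne_eq, mul_eq_zero, Nat.cast_eq_zero, Finset.card_eq_zero, Units.ne_zero, or_self,
    or_false]
  exact h.ne_empty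

/-- The triples having at least two elements in `T`. -/
def majorityTriples (T : Finset (Fin n)) : Finset (Finset (Fin n)) :=
  insert T ((T ×ˢ Tᶜ).image fun p => insert p.2 (T.erase p.1))

/-- Besides `T` itself, a triple is a choice of the element removed and of its replacement: 1 + 3(n
- 3). -/
theorem card_majorityTriples {T : Finset (Fin n)} (hT : T.card = 3) :
    (majorityTriples T).card + 8 = 3 * n := by
  have hc := Finset.card_compl_add_card T
  rw [hT, Fintype.card_fin] at hc
  rw [majorityTriples, Finset.card_insert_of_notMem, Finset.card_image_of_injOn,
    Finset.card_product, hT]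
  · omega
  · rintro ⟨s, a⟩ hs ⟨t, b⟩ ht he
    simp only [Finset.coe_product, Set.mem_prod, Finset.mem_coe, Finset.mem_compl] at hs ht he
    have hab : a = b := by
      have h1 : a ∈ insert b (T.erase t) := he ▸ Finset.mem_insert_self _ _
      rcases Finset.mem_insert.1 h1 with h1 | h1
      · exact h1
      · exact absurd (Finset.mem_of_mem_erase h1) hs.2
    have hst : s = t := by
      by_contra hst
      have h1 : s ∈ insert a (T.erase s) := by
        rw [he]; exact Finset.mem_insert_of_mem (Finset.mem_erase.2 ⟨hst, hs.1⟩)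
      rcases Finset.mem_insert.1 h1 with h1 | h1
      · exact hs.2 (h1 ▸ hs.1)
      · simp at h1
    rw [hab, hst]
  · rw [Finset.mem_image]
    rintro ⟨⟨s, a⟩, hs, he⟩
    simp only [Finset.mem_product, Finset.mem_compl] at hs he
    exact hs.2 (he ▸ Finset.mem_insert_self _ _)

theorem exists_erase_subset_of_mem_majorityTriples {T S : Finset (Fin n)} (hT : T.card = 3)
    (hS : S ∈ majorityTriples T) : S.card = 3 ∧ ∃ s, T.erase s ⊆ S := by
  rcases Finset.mem_insert.1 hS with rfl | hS
  · obtain ⟨s, hs⟩ := Finset.card_pos.1 (by omega : 0 < S.card)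
    exact ⟨hT, s, Finset.erase_subset _ _⟩
  · obtain ⟨⟨s, a⟩, hs, rfl⟩ := Finset.mem_image.1 hS
    simp only [Finset.mem_product, Finset.mem_compl] at hs
    refine ⟨?_, s, Finset.subset_insert _ _⟩
    rw [Finset.card_insert_of_notMem fun h => hs.2 (Finset.mem_of_mem_erase h),
      Finset.card_erase_of_mem hs.1, hT]

/-- Each triple misses at most one element of `T`, so some element of `T` lies in both. -/
theorem inter_nonempty_of_mem_majorityTriples {T S S' : Finset (Fin n)} (hT : T.card = 3)
    (hS : S ∈ majorityTriples T) (hS' : S' ∈ majorityTriples T) : (S ∩ S').Nonempty := by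
  obtain ⟨-, s, hs⟩ := exists_erase_subset_of_mem_majorityTriples hT hS
  obtain ⟨-, t, ht⟩ := exists_erase_subset_of_mem_majorityTriples hT hS'
  have h1 : 0 < ((T.erase s).erase t).card := by
    have e1 := Finset.pred_card_le_card_erase (s := T) (a := s)
    have e2 := Finset.pred_card_le_card_erase (s := T.erase s) (a := t)
    omega
  obtain ⟨i, hi⟩ := Finset.card_pos.1 h1
  simp only [Finset.mem_erase] at hi
  exact ⟨i, Finset.mem_inter.2 ⟨hs (by simp [hi]), ht (by simp [hi])⟩⟩

theorem Jpm.exists_indepSet (hn : 3 < n) :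
    ∃ I : Finset (JpmVertex n 3), (Jpm n 3 0).IsIndepSet (I : Set (JpmVertex n 3)) ∧
      NoCommonPlace I ∧ I.card + 16 = 6 * n := by
  classical
  obtain ⟨T, -, hT⟩ := Finset.exists_subset_card_eq
    (s := (Finset.univ : Finset (Fin n))) (n := 3) (by simpa using hn.le)
  have h3 := fun S : majorityTriples T => (exists_erase_subset_of_mem_majorityTriples hT S.2).1
  let f : majorityTriples T × ℤˣ → JpmVertex n 3 := fun p => JpmVertex.ofFinset p.1 (h3 p.1) p.2
  have hf : Function.Injective f := by
    rintro ⟨S, ε⟩ ⟨S', δ⟩ he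
    have h1 : S = S' := by
      have := congr_arg JpmVertex.supp he
      simp only [f, JpmVertex.supp_ofFinset] at this
      exact Subtype.ext this
    subst h1
    obtain ⟨i, hi⟩ := Finset.card_pos.1 (by rw [h3 S]; norm_num : 0 < (S : Finset (Fin n)).card)
    have h2 : (f (S, ε)).1 i = (f (S, δ)).1 i := by rw [he]
    simp only [f, JpmVertex.ofFinset, hi, if_true] at h2
    rw [Units.ext h2]
  refine ⟨Finset.univ.image f, ?_, ?_, ?_⟩
  · intro v hv w hw _ hadj
    simp only [Finset.coe_image, Finset.coe_univ, Set.image_univ, Set.mem_range] at hv hw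
    obtain ⟨p, rfl⟩ := hv
    obtain ⟨q, rfl⟩ := hw
    exact JpmVertex.ofFinset_dotProduct_ne_zero _ _ _ _
      (inter_nonempty_of_mem_majorityTriples hT p.1.2 q.1.2) hadj.2
  · rintro ⟨i, hi⟩
    have hi' : ∀ S ∈ majorityTriples T, i ∈ S := by
      intro S hS
      have := hi (f (⟨S, hS⟩, 1)) (Finset.mem_image_of_mem _ (Finset.mem_univ _))
      simpa only [f, JpmVertex.supp_ofFinset] using this
    have hiT : i ∈ T := hi' T (Finset.mem_insert_self _ _)
    -- Replacing `i` in `T` by an outside element gives a triple of the family that misses `i`.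
    obtain ⟨a, ha⟩ : (Tᶜ).Nonempty := by
      refine Finset.card_pos.1 ?_
      rw [Finset.card_compl, hT, Fintype.card_fin]
      omega
    have h1 := hi' (insert a (T.erase i)) (Finset.mem_insert_of_mem
      (Finset.mem_image.2 ⟨(i, a), Finset.mem_product.2 ⟨hiT, ha⟩, rfl⟩))
    rcases Finset.mem_insert.1 h1 with h1 | h1
    · exact (Finset.mem_compl.1 ha) (h1 ▸ hiT)
    · simp at h1
  · have h1 := card_majorityTriples hT
    rw [Finset.card_image_of_injective _ hf, Finset.card_univ, Fintype.card_prod,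
      Fintype.card_coe, Fintype.card_units_int]
    omega

end Jpm

theorem mainTheorem8 :
    ∃ n₀ : ℕ, ∀ n : ℕ, n₀ < n →
      (∀ I : Finset (JpmVertex n 3),
        (Jpm n 3 0).IsIndepSet (I : Set (JpmVertex n 3)) → NoCommonPlace I →
          (I.card : ℤ) ≤ 6 * (n : ℤ) - 16) ∧
      ∃ I : Finset (JpmVertex n 3),
        (Jpm n 3 0).IsIndepSet (I : Set (JpmVertex n 3)) ∧ NoCommonPlace I ∧
          (I.card : ℤ) = 6 * (n : ℤ) - 16 := by
  -- Any threshold with 4n + 224 ≤ 6n - 16 beyond it would do; 200 is not optimized.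
  refine ⟨200, fun n hn => ⟨fun I hI hc => ?_, ?_⟩⟩
  · have := Jpm.card_le_of_noCommonPlace hn hI hc
    omega
  · obtain ⟨I, h1, h2, h3⟩ := Jpm.exists_indepSet (by omega : 3 < n)
    exact ⟨I, h1, h2, by omega⟩
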